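/- **Theorem 4.1 (Prediction).** Let $T>0$ and let $X=(X_t)_{t\in[0,T]}$ be a regular invertible Gaussian Volterra process, represented by a function $m$ and a kernel $K$. This means the following. (i) $X$ is a centered Gaussian process with covariance $$R(t,s)=\mathbb E[X_tX_s]=\int_0^{t\wedge s}K(t,v)K(s,v)\,dm(v),\qquad s,t\in[0,T],$$ where $m:[0,T]\to\mathbb R_+$ is continuous and increasing, and $K\in L^2([0,T]^2,dm\times dm)$ is a Volterra kernel ($K(t,s)=0$ for $s>t$) with $K(t,\cdot)\in L^2(dm)$ for every $t$, such that for $0<s<T$ the map $t\mapsto K(t,s)$ is non-decreasing on $[s,T]$ and continuously differentiable on $(s,T]$, and $s\mapsto K(s,s)$ is continuously differentiable on $(0,T)$. (ii) For step functions $f$ put $$\mathrm K^*[f](s)=f(s)K(T,s)+\int_s^T[f(r)-f(s)]\,\frac{\partial K}{\partial r}(r,s)\,dr .$$ For $u\in[0,T]$ let $\Lambda_u$ be the completion of the space of linear combinations of the indicators $1_{[0,t)}$, $t\le u$, under $\|f\|^2=\int_0^T \mathrm K^*[f]^2\,dm$, and extend $\mathrm K^*:\Lambda_u\to L^2([0,T],dm)$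 and the Wiener integral $f\mapsto\int_0^u f(s)\,dX_s$, $\Lambda_u\to L^2(\mathbb P)$, given by $1_{[0,t)}\mapsto X_t$, by isometry. Then for each $t\in[0,T]$ the equation $\mathrm K^*[f]=1_{[0,t)}$ has a solution $f\in\Lambda_t$. Let $0\le u\le T$ and $\mathcal F_u^X=\sigma(X_s:s\le u)$. Then the conditional process $(X_t)_{t\in[u,T]}$ given $\mathcal F^X_u$ is Gaussian: there is a regular conditional law of it given $\mathcal F_u^X$ which is almost surely the law of a Gaussian process. For all $t,s\in[u,T]$ its mean and covariance are given as follows. * For each $t$ there is exactly one $\Psi(t,\cdot\,|u)\in\Lambda_u$ with $\mathrm K^*[\Psi(t,\cdot\,|u)]=1_{[0,u)}\,(K(t,\cdot)-K(u,\cdot))$, written $\Psi(t,\cdot\,|u)=(\mathrm K^*)^{-1}[K(t,\cdot)-K(u,\cdot)]$ on $[0,u]$, and almost surely $$\hat X_t(u)=\mathbb E[X_t\,|\,\mathcal F_u^X]=X_u+\int_0^u\Psi(t,s|u)\,dX_s .$$ * The conditional covariance is deterministic: almost surely $$\hat R(t,s|u)=\mathbb{C}\mathrm{ov}[X_t,X_s\,|\,\mathcal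 F_u^X]=R(t,s)-\int_0^uK(t,v)K(s,v)\,dm(v).$$ -/

import Mathlib

open MeasureTheory ProbabilityTheory Set
open scoped ENNReal

noncomputable section

namespace GaussianVolterra

/-- The measure `dm` on `(0, T]`. Only the restriction of `m` to `[0, T]` matters. -/
def bracketMeasure (T : ℝ) (m : StieltjesFunction ℝ) : Measure ℝ :=
  m.measure.restrict (Ioc 0 T)

/-- Regularity of the pair `(m, K)`: `m : [0, T] → ℝ₊` is continuous and increasing (monotonicity is
part of `StieltjesFunction`), and `K` is a square integrable Volterra kernel, non-decreasing and
continuously differentiable in its first variable off the diagonal, and continuously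
differentiable along the diagonal. The lines `s = 0` and `s = T` are `dm`-null and are left free,
since typical kernels are singular at `s = 0`. -/
structure RegularKernel (T : ℝ) (m : StieltjesFunction ℝ) (K : ℝ → ℝ → ℝ) : Prop where
  bracket_continuousOn : ContinuousOn m (Icc 0 T)
  bracket_nonneg : ∀ t ∈ Icc 0 T, 0 ≤ m t
  memLp_prod : MemLp (Function.uncurry K) 2 ((bracketMeasure T m).prod (bracketMeasure T m))
  memLp : ∀ t ∈ Icc 0 T, MemLp (K t) 2 (bracketMeasure T m)
  volterra : ∀ t s, 0 ≤ t → t < s → s ≤ T → K t s = 0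
  monotoneOn : ∀ s ∈ Ioo 0 T, MonotoneOn (fun t => K t s) (Icc s T)
  contDiffOn : ∀ s ∈ Ioo 0 T, ContDiffOn ℝ 1 (fun t => K t s) (Ioc s T)
  contDiffOn_diag : ContDiffOn ℝ 1 (fun s => K s s) (Ioo 0 T)

/-- The operator `K*[f](s) = f(s) K(T,s) + ∫_s^T [f(r) - f(s)] (∂K/∂r)(r,s) dr`. -/
def kStar (T : ℝ) (K : ℝ → ℝ → ℝ) (f : ℝ → ℝ) (s : ℝ) : ℝ :=
  f s * K T s + ∫ r in s..T, (f r - f s) * derivWithin (fun r => K r s) (Ioc s T) r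

variable {T : ℝ} {m : StieltjesFunction ℝ} {K : ℝ → ℝ → ℝ}

/-- Step functions on `[0, u]`, given by their (finitely many) coefficients with respect to the
indicators `1_{[0,t)}`, `t ≤ u`. The kernel and `m` are recorded because they determine the norm. -/
def StepFn (_ : RegularKernel T m K) (u : Icc (0 : ℝ) T) : Type := Iic u →₀ ℝ

namespace StepFn

variable {hK : RegularKernel T m K} {u : Icc (0 : ℝ) T}

instance : AddCommGroup (StepFn hK u) := inferInstanceAs (AddCommGroup (Iic u →₀ ℝ))

instance : Module ℝ (StepFn hK u) := inferInstanceAs (Module ℝ (Iic u →₀ ℝ))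

/-- The actual step function `∑ aₜ 1_{[0,t)}`. -/
def eval : StepFn hK u →ₗ[ℝ] (ℝ → ℝ) :=
  Finsupp.linearCombination ℝ (fun t : Iic u => (Ico (0 : ℝ) (t : Icc (0 : ℝ) T)).indicator 1)

end StepFn

theorem bracketMeasure_singleton (hK : RegularKernel T m K) (x : ℝ) :
    bracketMeasure T m {x} = 0 := by
  rw [bracketMeasure, Measure.restrict_apply (measurableSet_singleton x)]
  by_cases hx : x ∈ Ioc 0 T
  · rw [inter_eq_left.2 (singleton_subset_iff.2 hx), StieltjesFunction.measure_singleton]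
    have h1 : Filter.Tendsto m (nhdsWithin x (Iio x)) (nhds (m x)) := by
      have h2 := hK.bracket_continuousOn x ⟨hx.1.le, hx.2⟩
      refine h2.tendsto.mono_left ?_
      rw [← nhdsWithin_Ioo_eq_nhdsLT hx.1]
      exact nhdsWithin_mono _ fun y hy => ⟨hy.1.le, hy.2.le.trans hx.2⟩
    rw [leftLim_eq_of_tendsto h1]
    simp
  · rw [singleton_inter_eq_empty.2 hx]
    simp

theorem ae_mem_Ioo (hK : RegularKernel T m K) : ∀ᵐ s ∂(bracketMeasure T m), s ∈ Ioo 0 T := by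
  have h1 : ∀ᵐ s ∂(bracketMeasure T m), s ∈ Ioc 0 T := ae_restrict_mem measurableSet_Ioc
  have h2 : ∀ᵐ s ∂(bracketMeasure T m), s ≠ T := by
    rw [ae_iff]
    simpa using bracketMeasure_singleton hK T
  filter_upwards [h1, h2] with s hs hs'
  exact ⟨hs.1, lt_of_le_of_ne hs.2 hs'⟩

theorem intervalIntegrable_deriv (hK : RegularKernel T m K) {s t : ℝ} (hs : s ∈ Ioo 0 T)
    (hst : s < t) (htT : t ≤ T) :
    IntervalIntegrable (fun r => derivWithin (fun r => K r s) (Ioc s T) r) volume t T := by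
  have h := (hK.contDiffOn s hs).continuousOn_derivWithin (uniqueDiffOn_Ioc s T) le_rfl
  refine ContinuousOn.intervalIntegrable (h.mono ?_)
  rw [uIcc_of_le htT]
  exact fun r hr => ⟨hst.trans_le hr.1, hr.2⟩

theorem intervalIntegrable_indicator (hK : RegularKernel T m K) {s t : ℝ} (hs : s ∈ Ioo 0 T)
    (htT : t ≤ T) :
    IntervalIntegrable (fun r => ((Ico 0 t).indicator (1 : ℝ → ℝ) r -
      (Ico 0 t).indicator (1 : ℝ → ℝ) s) * derivWithin (fun r => K r s) (Ioc s T) r)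
      volume s T := by
  rcases lt_or_ge s t with h | h
  · have h1 : IntervalIntegrable (fun r => ((Ico 0 t).indicator (1 : ℝ → ℝ) r -
        (Ico 0 t).indicator (1 : ℝ → ℝ) s) * derivWithin (fun r => K r s) (Ioc s T) r)
        volume s t := by
      refine IntervalIntegrable.congr_uIoo (f := fun _ => (0 : ℝ)) intervalIntegrable_const ?_
      intro r hr
      rw [uIoo_of_le h.le] at hr
      have hr' : r ∈ Ico 0 t := ⟨(hs.1.trans hr.1).le, hr.2⟩
      have hs' : s ∈ Ico 0 t := ⟨hs.1.le, h⟩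
      simp [hr', hs']
    refine h1.trans ?_
    refine IntervalIntegrable.congr_uIoo (intervalIntegrable_deriv hK hs h htT).neg ?_
    intro r hr
    rw [uIoo_of_le htT] at hr
    have hr' : r ∉ Ico 0 t := fun h' => absurd h'.2 (not_lt.2 hr.1.le)
    have hs' : s ∈ Ico 0 t := ⟨hs.1.le, h⟩
    simp only [indicator_of_notMem hr', indicator_of_mem hs', Pi.neg_apply, Pi.one_apply]
    ring
  · refine IntervalIntegrable.congr_uIoo (f := fun _ => (0 : ℝ)) intervalIntegrable_const ?_
    intro r hr
    rw [uIoo_of_le hs.2.le] at hr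
    have hr' : r ∉ Ico 0 t := fun h' => absurd h'.2 (not_lt.2 (h.trans hr.1.le))
    have hs' : s ∉ Ico 0 t := fun h' => absurd h'.2 (not_lt.2 h)
    simp [hr', hs']

/-- `K*[1_{[0,t)}] = K(t, ·)`. -/
theorem kStar_indicator (hK : RegularKernel T m K) {s t : ℝ} (hs : s ∈ Ioo 0 T)
    (htT : t ≤ T) (hst : s ≠ t) (ht : 0 ≤ t) :
    kStar T K ((Ico 0 t).indicator 1) s = K t s := by
  rcases lt_or_ge s t with h | h
  · have hs' : s ∈ Ico 0 t := ⟨hs.1.le, h⟩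
    rw [kStar, ← intervalIntegral.integral_add_adjacent_intervals (b := t)]
    · have h1 : (∫ r in s..t, ((Ico 0 t).indicator (1 : ℝ → ℝ) r -
          (Ico 0 t).indicator (1 : ℝ → ℝ) s) * derivWithin (fun r => K r s) (Ioc s T) r)
          = ∫ r in s..t, (0 : ℝ) := by
        refine intervalIntegral.integral_congr_Ioo_of_le h.le ?_
        intro r hr
        have hr' : r ∈ Ico 0 t := ⟨(hs.1.trans hr.1).le, hr.2⟩
        simp [hr', hs']
      have h2 : (∫ r in t..T, ((Ico 0 t).indicator (1 : ℝ → ℝ) r -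
          (Ico 0 t).indicator (1 : ℝ → ℝ) s) * derivWithin (fun r => K r s) (Ioc s T) r)
          = ∫ r in t..T, - derivWithin (fun r => K r s) (Ioc s T) r := by
        refine intervalIntegral.integral_congr_Ioo_of_le htT ?_
        intro r hr
        have hr' : r ∉ Ico 0 t := fun h' => absurd h'.2 (not_lt.2 hr.1.le)
        simp only [indicator_of_notMem hr', indicator_of_mem hs', Pi.one_apply]
        ring
      have h3 : (∫ r in t..T, derivWithin (fun r => K r s) (Ioc s T) r) = K T s - K t s := by
        have hsub : Icc t T ⊆ Ioc s T := fun r hr => ⟨h.trans_le hr.1, hr.2⟩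
        refine intervalIntegral.integral_eq_sub_of_hasDerivAt_of_le htT
          ((hK.contDiffOn s hs).continuousOn.mono hsub) ?_ (intervalIntegrable_deriv hK hs h htT)
        intro r hr
        have hd := ((hK.contDiffOn s hs).differentiableOn one_ne_zero r
          (hsub (Ioo_subset_Icc_self hr))).hasDerivWithinAt
        exact hd.hasDerivAt (Ioc_mem_nhds (h.trans hr.1) hr.2)
      rw [h1, h2, intervalIntegral.integral_neg, h3]
      simp [hs']
    · refine (IntervalIntegrable.mono_set (intervalIntegrable_indicator hK hs htT) ?_)
      rw [uIcc_of_le h.le, uIcc_of_le hs.2.le]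
      exact Icc_subset_Icc_right htT
    · refine (IntervalIntegrable.mono_set (intervalIntegrable_indicator hK hs htT) ?_)
      rw [uIcc_of_le htT, uIcc_of_le hs.2.le]
      exact Icc_subset_Icc_left h.le
  · have hs' : s ∉ Ico 0 t := fun h' => absurd h'.2 (not_lt.2 h)
    rw [kStar, hK.volterra t s ht (lt_of_le_of_ne h (Ne.symm hst)) hs.2.le]
    have h1 : (∫ r in s..T, ((Ico 0 t).indicator (1 : ℝ → ℝ) r -
          (Ico 0 t).indicator (1 : ℝ → ℝ) s) * derivWithin (fun r => K r s) (Ioc s T) r)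
          = ∫ r in s..T, (0 : ℝ) := by
      refine intervalIntegral.integral_congr_Ioo_of_le hs.2.le ?_
      intro r hr
      have hr' : r ∉ Ico 0 t := fun h' => absurd h'.2 (not_lt.2 (h.trans hr.1.le))
      simp [hr', hs']
    rw [h1]
    simp [hs']

/-- On a step function `K*` is given by linearity. -/
theorem kStar_eval (hK : RegularKernel T m K) {u : Icc (0 : ℝ) T} (f : StepFn hK u) {s : ℝ}
    (hs : s ∈ Ioo 0 T) :
    kStar T K f.eval s =
      Finsupp.sum f fun t a => a * kStar T K ((Ico (0 : ℝ) (t : Icc (0 : ℝ) T)).indicator 1) s := by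
  have hev : ∀ r, StepFn.eval f r = Finsupp.sum f fun t a =>
      a * (Ico (0 : ℝ) (t : Icc (0 : ℝ) T)).indicator (1 : ℝ → ℝ) r := by
    intro r
    refine (congrFun (Finsupp.linearCombination_apply ℝ f) r).trans ?_
    exact Finset.sum_apply _ _ _
  simp only [kStar, hev, Finsupp.sum, mul_add, Finset.sum_add_distrib, Finset.sum_mul,
    ← intervalIntegral.integral_const_mul]
  rw [← intervalIntegral.integral_finsetSum]
  · congr 1
    · exact Finset.sum_congr rfl fun t _ => by ring
    · refine intervalIntegral.integral_congr fun r _ => ?_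
      simp only [← Finset.sum_sub_distrib, Finset.sum_mul]
      exact Finset.sum_congr rfl fun t _ => by ring
  · intro t _
    exact (intervalIntegrable_indicator hK hs t.1.2.2).const_mul _

/-- `K*[∑ aₜ 1_{[0,t)}] = ∑ aₜ K(t, ·)` almost everywhere. -/
theorem kStar_eval_ae (hK : RegularKernel T m K) {u : Icc (0 : ℝ) T} (f : StepFn hK u) :
    kStar T K f.eval =ᵐ[bracketMeasure T m]
      fun s => Finsupp.sum f fun t a => a * K (t : Icc (0 : ℝ) T) s := by
  have h : ∀ᵐ s ∂(bracketMeasure T m), ∀ t ∈ Finsupp.support f, s ≠ ((t : Icc (0 : ℝ) T) : ℝ) := by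
    refine (Finset.eventually_all _).2 fun t _ => ?_
    rw [ae_iff]
    simpa using bracketMeasure_singleton hK ((t : Icc (0 : ℝ) T) : ℝ)
  filter_upwards [ae_mem_Ioo hK, h] with s hs hst
  rw [kStar_eval hK f hs]
  refine Finset.sum_congr rfl fun t ht => ?_
  simp only
  rw [kStar_indicator hK hs t.1.2.2 (hst t ht) t.1.2.1]

theorem memLp_kStar (hK : RegularKernel T m K) {u : Icc (0 : ℝ) T} (f : StepFn hK u) :
    MemLp (kStar T K f.eval) 2 (bracketMeasure T m) := by
  refine MemLp.ae_eq (kStar_eval_ae hK f).symm ?_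
  exact memLp_finsetSum _ fun t _ => (hK.memLp t t.1.2).const_mul _

/-- `K*` on step functions, with values in `L²(dm)`. -/
def kStarStep (hK : RegularKernel T m K) (u : Icc (0 : ℝ) T) :
    StepFn hK u →ₗ[ℝ] Lp ℝ 2 (bracketMeasure T m) where
  toFun f := (memLp_kStar hK f).toLp _
  map_add' f g := by
    rw [← MemLp.toLp_add, MemLp.toLp_eq_toLp_iff]
    filter_upwards [kStar_eval_ae hK f, kStar_eval_ae hK g, kStar_eval_ae hK (f + g)] with s h1 h2 h3
    rw [Pi.add_apply, h1, h2, h3]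
    exact Finsupp.sum_add_index' (fun _ => zero_mul _) (fun _ _ _ => add_mul _ _ _)
  map_smul' c f := by
    rw [RingHom.id_apply, ← MemLp.toLp_const_smul, MemLp.toLp_eq_toLp_iff]
    filter_upwards [kStar_eval_ae hK f, kStar_eval_ae hK (c • f)] with s h1 h3
    rw [Pi.smul_apply, h1, h3]
    refine (Finsupp.sum_smul_index' (fun _ => zero_mul _)).trans ?_
    simp [Finsupp.sum, Finset.mul_sum, mul_assoc]

/-- The seminorm `‖f‖² = ∫ K*[f]² dm` on step functions. -/
instance (hK : RegularKernel T m K) (u : Icc (0 : ℝ) T) : SeminormedAddCommGroup (StepFn hK u) :=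
  SeminormedAddCommGroup.induced _ _ (kStarStep hK u)

/-- The space of integrands on `[0, u]`: the closure (completion) of the step functions on `[0, u]`
under the isometry `f ↦ K*[f]`. -/
abbrev Integrand (hK : RegularKernel T m K) (u : Icc (0 : ℝ) T) : Type :=
  UniformSpace.Completion (StepFn hK u)

theorem norm_stepFn (hK : RegularKernel T m K) (u : Icc (0 : ℝ) T) (f : StepFn hK u) :
    ‖f‖ = ‖kStarStep hK u f‖ := rfl

/-- The operator `K*` extended by continuity from step functions to all integrands on `[0, u]`. -/
def kStarExt (hK : RegularKernel T m K) (u : Icc (0 : ℝ) T) :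
    Integrand hK u → Lp ℝ 2 (bracketMeasure T m) :=
  UniformSpace.Completion.extension (kStarStep hK u)

theorem kStarExt_coe (hK : RegularKernel T m K) (u : Icc (0 : ℝ) T) (f : StepFn hK u) :
    kStarExt hK u f = kStarStep hK u f :=
  UniformSpace.Completion.extension_coe
    (AddMonoidHomClass.uniformContinuous_of_bound (kStarStep hK u) 1
      fun f => by rw [one_mul, norm_stepFn]) f

variable {Ω : Type*} [MeasurableSpace Ω]

/-- `X` is a regular invertible Gaussian Volterra process on `[0, T]`, represented by `m` and the
kernel `K`: it is centered Gaussian with `E[X_t X_s] = ∫_0^{t∧s} K(t,v) K(s,v) dm(v)`, and, for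
each `t`, the equation `K*[f] = 1_{[0,t)}` has a solution among the integrands on `[0, t]`. -/
structure IsRegularInvertible (T : ℝ) (m : StieltjesFunction ℝ) (K : ℝ → ℝ → ℝ)
    (X : Icc (0 : ℝ) T → Ω → ℝ) (P : Measure Ω) : Prop where
  measurable : ∀ t, Measurable (X t)
  gaussian : IsGaussianProcess X P
  centered : ∀ t, ∫ ω, X t ω ∂P = 0
  kernel : RegularKernel T m K
  covariance : ∀ t s : Icc (0 : ℝ) T, ∫ ω, X t ω * X s ω ∂P =
    ∫ v in Ioc 0 (min (t : ℝ) s), K t v * K s v ∂m.measure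
  invertible : ∀ t : Icc (0 : ℝ) T, ∃ f : Integrand kernel t,
    kStarExt kernel t f =ᵐ[bracketMeasure T m] (Ico 0 (t : ℝ)).indicator 1

variable {P : Measure Ω} {X : Icc (0 : ℝ) T → Ω → ℝ}

/-- The integral `∫ f dX` of a step function: `∑ aₜ 1_{[0,t)} ↦ ∑ aₜ X_t`, in `L²(P)`. -/
def wienerStep (hX : IsRegularInvertible T m K X P) (u : Icc (0 : ℝ) T) :
    StepFn hX.kernel u →ₗ[ℝ] Lp ℝ 2 P :=
  Finsupp.linearCombination ℝ (fun t : Iic u => (hX.gaussian.hasGaussianLaw_eval t.1).memLp_two.toLp)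

theorem kStarStep_single (hK : RegularKernel T m K) (u : Icc (0 : ℝ) T) (t : Iic u) :
    kStarStep hK u (Finsupp.single t 1) = (hK.memLp t t.1.2).toLp := by
  change (memLp_kStar hK (Finsupp.single t 1)).toLp _ = _
  rw [MemLp.toLp_eq_toLp_iff]
  filter_upwards [kStar_eval_ae (u := u) hK (Finsupp.single t 1)] with s h
  rw [h]
  exact (Finsupp.sum_single_index (zero_mul _)).trans (one_mul _)

theorem wienerStep_single (hX : IsRegularInvertible T m K X P) (u : Icc (0 : ℝ) T) (t : Iic u) :
    wienerStep hX u (Finsupp.single t 1) =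
      (hX.gaussian.hasGaussianLaw_eval t.1).memLp_two.toLp :=
  (Finsupp.linearCombination_single ℝ _ _).trans (one_smul _ _)

/-- The isometry `E[∫ f dX ∫ g dX] = ∫ K*[f] K*[g] dm` for step functions. -/
theorem inner_wienerStep (hX : IsRegularInvertible T m K X P) (u : Icc (0 : ℝ) T)
    (f g : StepFn hX.kernel u) :
    inner ℝ (wienerStep hX u f) (wienerStep hX u g) =
      inner ℝ (kStarStep hX.kernel u f) (kStarStep hX.kernel u g) := by
  have h : (innerₗ _).compl₁₂ (wienerStep hX u) (wienerStep hX u) =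
      (innerₗ _).compl₁₂ (kStarStep hX.kernel u) (kStarStep hX.kernel u) := by
    refine Finsupp.lhom_ext' fun t => LinearMap.ext_ring ?_
    refine Finsupp.lhom_ext' fun s => LinearMap.ext_ring ?_
    change inner ℝ (wienerStep hX u (Finsupp.single t 1)) (wienerStep hX u (Finsupp.single s 1)) =
      inner ℝ (kStarStep hX.kernel u (Finsupp.single t 1))
        (kStarStep hX.kernel u (Finsupp.single s 1))
    rw [kStarStep_single, kStarStep_single, wienerStep_single, wienerStep_single, L2.inner_def,
      L2.inner_def]
    have h1 : ∫ ω, inner ℝ ((hX.gaussian.hasGaussianLaw_eval t.1).memLp_two.toLp _ ω)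
        ((hX.gaussian.hasGaussianLaw_eval s.1).memLp_two.toLp _ ω) ∂P =
        ∫ ω, X s ω * X t ω ∂P := by
      refine integral_congr_ae ?_
      filter_upwards [(hX.gaussian.hasGaussianLaw_eval t.1).memLp_two.coeFn_toLp,
        (hX.gaussian.hasGaussianLaw_eval s.1).memLp_two.coeFn_toLp] with ω h1 h2
      rw [h1, h2]
      rfl
    have h2 : ∫ v, inner ℝ ((hX.kernel.memLp t t.1.2).toLp _ v)
        ((hX.kernel.memLp s s.1.2).toLp _ v) ∂(bracketMeasure T m) =
        ∫ v in Ioc 0 T, K s v * K t v ∂m.measure := by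
      refine integral_congr_ae ?_
      filter_upwards [(hX.kernel.memLp t t.1.2).coeFn_toLp,
        (hX.kernel.memLp s s.1.2).coeFn_toLp] with v h1 h2
      rw [h1, h2]
      rfl
    rw [h1, h2, hX.covariance]
    refine (setIntegral_eq_of_subset_of_forall_sdiff_eq_zero measurableSet_Ioc
      (Ioc_subset_Ioc_right ((min_le_left _ _).trans s.1.2.2)) ?_).symm
    rintro v ⟨hv, hv'⟩
    rcases min_lt_iff.1 (not_le.1 fun h => hv' ⟨hv.1, h⟩) with h | h
    · rw [hX.kernel.volterra _ v s.1.2.1 h hv.2, zero_mul]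
    · rw [hX.kernel.volterra _ v t.1.2.1 h hv.2, mul_zero]
  exact LinearMap.congr_fun (LinearMap.congr_fun h f) g

theorem norm_wienerStep (hX : IsRegularInvertible T m K X P) (u : Icc (0 : ℝ) T)
    (f : StepFn hX.kernel u) : ‖wienerStep hX u f‖ = ‖f‖ := by
  rw [norm_stepFn, @norm_eq_sqrt_real_inner, @norm_eq_sqrt_real_inner, inner_wienerStep]

/-- The Wiener integral `∫_0^u f dX`, extended by isometry from step functions to all integrands. -/
def wienerIntegral (hX : IsRegularInvertible T m K X P) (u : Icc (0 : ℝ) T) :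
    Integrand hX.kernel u → Lp ℝ 2 P :=
  UniformSpace.Completion.extension (wienerStep hX u)

theorem wienerIntegral_coe (hX : IsRegularInvertible T m K X P) (u : Icc (0 : ℝ) T)
    (f : StepFn hX.kernel u) : wienerIntegral hX u f = wienerStep hX u f :=
  UniformSpace.Completion.extension_coe
    (AddMonoidHomClass.uniformContinuous_of_bound (wienerStep hX u) 1
      fun f => by rw [one_mul, norm_wienerStep]) f

/-- The `σ`-algebra generated by `X_s`, `s ≤ u`. -/
@[reducible]
def past (X : Icc (0 : ℝ) T → Ω → ℝ) (u : Icc (0 : ℝ) T) : MeasurableSpace Ω :=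
  ⨆ s ∈ Iic u, MeasurableSpace.comap (X s) inferInstance

/-- The conditional covariance of `X` and `Y` given the `σ`-algebra `𝓖`. -/
def condCov {Ω : Type*} (𝓖 : MeasurableSpace Ω) {mΩ : MeasurableSpace Ω} (P : Measure Ω) (X Y : Ω → ℝ) : Ω → ℝ :=
  P[(X - P[X | 𝓖]) * (Y - P[Y | 𝓖]) | 𝓖]

/-- `κ` is a regular conditional law of `Y` given the `σ`-algebra `𝓖`. -/
def IsRegularCondLaw {Ω E : Type*} [MeasurableSpace E] (𝓖 : MeasurableSpace Ω)
    {mΩ : MeasurableSpace Ω} (P : Measure Ω) (Y : Ω → E) (κ : @Kernel Ω E 𝓖 _) : Prop :=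
  (∀ ω, IsProbabilityMeasure (κ ω)) ∧
    ∀ A, MeasurableSet[𝓖] A → ∀ B, MeasurableSet B → ∫⁻ ω in A, κ ω B ∂P = P (A ∩ Y ⁻¹' B)

end GaussianVolterra

end

/-!
# Prediction of regular invertible Gaussian Volterra processes

The isometry `K*` identifies the integrands on `[0, u]` with a closed subspace of `L²(dm)`, namely
the closed span of the kernels `K(t,·)`, `t ≤ u`. Invertibility puts every `1_{[0,t)}`, `t ≤ u`, into
this subspace, and a function orthogonal to all of them vanishes on `[0, u)`. Hence `K*` maps onto
all functions that vanish outside `[0, u)` (`exists_kStarExt_eq_indicator`). This gives `Ψ`,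
and `Φ = 1_{[0,u)} + Ψ` is the integrand whose image is the part of `K(t,·)` on `[0, u)`.

Put `M t = ∫ Φ dX = X u + ∫ Ψ dX` and `Z t = X t - M t`. The isometry turns the covariance of `Z t`
with an integral over `[0, u]` into the inner product of `1_{[u,T]} K(t,·)` with a function that
vanishes outside `[0, u)`, which is zero (`inner_sub_wienerIntegral`). All these variables lie in one
Gaussian Hilbert space, where any family is jointly Gaussian because limits in `L²` of centered
Gaussian variables are Gaussian (`isGaussianProcess_of_mem_gaussianSpace`). So `Z` is not only
uncorrelated with the past but independent of it as a process (`indep_past_remainder`).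

Consequently `X = M + Z` with `M` determined by the past and `Z` independent of it: the conditional
mean is `M`, the conditional covariance is that of `Z`, and translating the law of `Z` by `M ω`
gives a regular conditional law, Gaussian for every `ω`. Since the translated law depends
measurably on `ω` without any regularity of paths, the uncountable index set is harmless.
-/

noncomputable section

namespace GaussianVolterra

/-! ### Gaussian Hilbert spaces -/

section GaussianSpace

variable {Ω ι : Type*} [MeasurableSpace Ω] {P : Measure Ω}

theorem integral_norm_le_norm_Lp_two [IsProbabilityMeasure P] (f : Lp ℝ 2 P) :
    ∫ ω, ‖f ω‖ ∂P ≤ ‖f‖ := by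
  rw [integral_norm_eq_lintegral_enorm (Lp.aestronglyMeasurable f), Lp.norm_def,
    ← eLpNorm_one_eq_lintegral_enorm]
  exact ENNReal.toReal_mono (Lp.eLpNorm_ne_top f)
    (eLpNorm_le_eLpNorm_of_exponent_le (by norm_num) (Lp.aestronglyMeasurable f))

theorem lipschitzWith_charFun_Lp_two [IsProbabilityMeasure P] (ξ : ℝ) :
    LipschitzWith ‖ξ‖₊ fun f : Lp ℝ 2 P => charFun (P.map f) ξ := by
  refine LipschitzWith.of_dist_le_mul fun f g => ?_
  have hint : ∀ h : Lp ℝ 2 P, Integrable (fun ω => Complex.exp (ξ * h ω * Complex.I)) P := by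
    intro h
    refine Integrable.of_bound (C := 1) ?_ (ae_of_all _ fun ω => ?_)
    · have := Lp.aestronglyMeasurable h
      fun_prop
    · rw [← Complex.ofReal_mul, Complex.norm_exp_ofReal_mul_I]
  have hchar : ∀ h : Lp ℝ 2 P,
      charFun (P.map h) ξ = ∫ ω, Complex.exp (ξ * h ω * Complex.I) ∂P := by
    intro h
    rw [charFun_apply_real, integral_map (Lp.aestronglyMeasurable h).aemeasurable (by fun_prop)]
  rw [dist_eq_norm, dist_eq_norm, hchar, hchar, ← integral_sub (hint f) (hint g)]
  calc ‖∫ ω, (Complex.exp (ξ * f ω * Complex.I) - Complex.exp (ξ * g ω * Complex.I)) ∂P‖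
      ≤ ∫ ω, ‖ξ‖ * ‖(f - g) ω‖ ∂P := by
        refine norm_integral_le_of_norm_le
          (((Lp.memLp (f - g)).integrable one_le_two).norm.const_mul _) ?_
        filter_upwards [Lp.coeFn_sub f g] with ω hω
        have h1 : Complex.exp (ξ * f ω * Complex.I) - Complex.exp (ξ * g ω * Complex.I) =
            Complex.exp ((ξ * g ω : ℝ) * Complex.I) *
              (Complex.exp (Complex.I * (ξ * (f ω - g ω) : ℝ)) - 1) := by
          rw [mul_sub, ← Complex.exp_add, mul_one]
          push_cast
          ring_nf
        rw [h1, norm_mul, Complex.norm_exp_ofReal_mul_I, one_mul, hω, Pi.sub_apply, ← norm_mul]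
        exact Real.norm_exp_I_mul_ofReal_sub_one_le
    _ ≤ ‖ξ‖ * ‖f - g‖ := by
        rw [integral_const_mul]
        gcongr
        exact integral_norm_le_norm_Lp_two _

/-- The elements of `L²(P)` with law `N(0, σ²)`. The variance is necessarily the square of the
norm, which makes the condition on characteristic functions one that passes to limits. -/
def centeredGaussians (P : Measure Ω) : Set (Lp ℝ 2 P) :=
  {f | P.map f = gaussianReal 0 (‖f‖₊ ^ 2)}

theorem isClosed_centeredGaussians [IsProbabilityMeasure P] :
    IsClosed (centeredGaussians P) := by
  have h : centeredGaussians P = ⋂ ξ : ℝ, {f : Lp ℝ 2 P | charFun (P.map f) ξ =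
      Complex.exp (-((‖f‖ : ℂ) ^ 2 * ξ ^ 2 / 2))} := by
    ext f
    have hprob : IsProbabilityMeasure (P.map f) :=
      Measure.isProbabilityMeasure_map (Lp.aestronglyMeasurable f).aemeasurable
    have hgauss : ∀ ξ : ℝ, charFun (gaussianReal 0 (‖f‖₊ ^ 2)) ξ =
        Complex.exp (-((‖f‖ : ℂ) ^ 2 * ξ ^ 2 / 2)) := by
      intro ξ
      rw [charFun_gaussianReal]
      simp
    simp only [mem_iInter, mem_ofPred_eq, centeredGaussians]
    refine ⟨fun hf ξ => by rw [hf, hgauss], fun hf => Measure.ext_of_charFun ?_⟩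
    ext ξ
    rw [hf, hgauss]
  rw [h]
  refine isClosed_iInter fun ξ => isClosed_eq (lipschitzWith_charFun_Lp_two ξ).continuous ?_
  fun_prop

theorem norm_toLp_sq {f : Ω → ℝ} (hf : MemLp f 2 P) : ‖hf.toLp‖ ^ 2 = ∫ ω, f ω ^ 2 ∂P := by
  rw [← real_inner_self_eq_norm_sq, L2.inner_def]
  refine integral_congr_ae ?_
  filter_upwards [hf.coeFn_toLp] with ω hω
  rw [hω, real_inner_self_eq_norm_sq, Real.norm_eq_abs, sq_abs]

theorem toLp_mem_centeredGaussians {f : Ω → ℝ} (hf : HasGaussianLaw f P)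
    (h0 : ∫ ω, f ω ∂P = 0) : hf.memLp_two.toLp ∈ centeredGaussians P := by
  have hvar : Var[f; P].toNNReal = ‖hf.memLp_two.toLp‖₊ ^ 2 := by
    rw [variance_of_integral_eq_zero hf.aemeasurable h0]
    refine NNReal.coe_injective ?_
    rw [Real.coe_toNNReal _ (integral_nonneg fun _ => sq_nonneg _), NNReal.coe_pow, coe_nnnorm,
      norm_toLp_sq]
  rw [centeredGaussians, mem_ofPred_eq, Measure.map_congr hf.memLp_two.coeFn_toLp,
    hf.map_eq_gaussianReal, h0, hvar]

variable {X : ι → Ω → ℝ}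

/-- The Gaussian Hilbert space of the process `X`: the closed subspace of `L²(P)` generated by
the variables `X t`. -/
def gaussianSpace (hX : IsGaussianProcess X P) : Submodule ℝ (Lp ℝ 2 P) :=
  (Submodule.span ℝ (range fun t => (hX.hasGaussianLaw_eval t).memLp_two.toLp)).topologicalClosure

theorem toLp_mem_gaussianSpace (hX : IsGaussianProcess X P) (t : ι) :
    (hX.hasGaussianLaw_eval t).memLp_two.toLp ∈ gaussianSpace hX :=
  Submodule.le_topologicalClosure _ (Submodule.subset_span (mem_range_self t))

theorem gaussianSpace_subset_centeredGaussians (hX : IsGaussianProcess X P)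
    (h0 : ∀ t, ∫ ω, X t ω ∂P = 0) :
    (gaussianSpace hX : Set (Lp ℝ 2 P)) ⊆ centeredGaussians P := by
  have := hX.isProbabilityMeasure
  rw [gaussianSpace, Submodule.topologicalClosure_coe]
  refine closure_minimal ?_ isClosed_centeredGaussians
  intro f hf
  obtain ⟨c, rfl⟩ := Finsupp.mem_span_range_iff_exists_finsupp.1 hf
  have hlaw : HasGaussianLaw (fun ω => ∑ t ∈ c.support, c t • X t ω) P :=
    (hX.smul c).hasGaussianLaw_fun_sum
  have hmean : ∫ ω, ∑ t ∈ c.support, c t • X t ω ∂P = 0 := by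
    rw [integral_finsetSum _ fun t _ => (hX.hasGaussianLaw_eval t).integrable.fun_smul (c t)]
    refine Finset.sum_eq_zero fun t _ => ?_
    rw [integral_smul, h0, smul_zero]
  convert toLp_mem_centeredGaussians hlaw hmean using 1
  refine Lp.ext ?_
  have h1 : ∀ᵐ ω ∂P, ∀ t ∈ c.support,
      (c t • (hX.hasGaussianLaw_eval t).memLp_two.toLp) ω = c t • X t ω := by
    refine (Finset.eventually_all _).2 fun t _ => ?_
    filter_upwards [Lp.coeFn_smul (c t) (hX.hasGaussianLaw_eval t).memLp_two.toLp,
      (hX.hasGaussianLaw_eval t).memLp_two.coeFn_toLp] with ω h2 h3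
    rw [h2, Pi.smul_apply, h3]
  filter_upwards [h1, hlaw.memLp_two.coeFn_toLp, Lp.coeFn_finsetSum c.support
    fun t => c t • (hX.hasGaussianLaw_eval t).memLp_two.toLp] with ω h1 h2 h3
  rw [Finsupp.sum, h2, h3, Finset.sum_apply]
  exact Finset.sum_congr rfl h1

/-- Any family in a Gaussian Hilbert space is jointly Gaussian, since the finite linear
combinations of its members are again in the space. -/
theorem isGaussianProcess_of_mem_gaussianSpace (hX : IsGaussianProcess X P)
    (h0 : ∀ t, ∫ ω, X t ω ∂P = 0) {κ : Type*} {Y : κ → Ω → ℝ} {y : κ → Lp ℝ 2 P}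
    (hy : ∀ i, y i ∈ gaussianSpace hX) (hYy : ∀ i, Y i =ᵐ[P] y i) : IsGaussianProcess Y P where
  hasGaussianLaw I := by
    classical
    have := hX.isProbabilityMeasure
    have hY : ∀ i, AEMeasurable (Y i) P := fun i =>
      (Lp.aestronglyMeasurable (y i)).aemeasurable.congr (hYy i).symm
    have hYI : AEMeasurable (fun ω => I.restrict (Y · ω)) P :=
      aemeasurable_pi_lambda _ fun i => hY i
    refine ⟨isGaussian_of_map_eq_gaussianReal fun L => ?_⟩
    let z : Lp ℝ 2 P := ∑ i : I, L (Pi.single i 1) • y i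
    have hz : z ∈ gaussianSpace hX :=
      Submodule.sum_mem _ fun i _ => Submodule.smul_mem _ _ (hy i)
    refine ⟨0, ‖z‖₊ ^ 2, ?_⟩
    rw [← gaussianSpace_subset_centeredGaussians hX h0 hz,
      AEMeasurable.map_map_of_aemeasurable (by fun_prop) hYI]
    refine Measure.map_congr ?_
    have h1 : ∀ᵐ ω ∂P, ∀ i : I,
        (L (Pi.single i 1) • y i) ω = L (Pi.single i 1) • Y i ω := by
      refine ae_all_iff.2 fun i => ?_
      filter_upwards [Lp.coeFn_smul (L (Pi.single i 1)) (y i), hYy i] with ω h2 h3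
      rw [h2, Pi.smul_apply, h3]
    filter_upwards [h1, Lp.coeFn_finsetSum Finset.univ
      fun i : I => L (Pi.single i 1) • y i] with ω h1 h2
    rw [h2, Finset.sum_apply, Finset.sum_congr rfl fun i _ => h1 i, Function.comp_apply]
    conv_lhs => rw [← Finset.univ_sum_single (I.restrict (Y · ω)), map_sum]
    refine Finset.sum_congr rfl fun i _ => ?_
    rw [smul_eq_mul, mul_comm, ← smul_eq_mul, ← map_smul, ← Pi.single_smul, smul_eq_mul, mul_one]
    rfl

end GaussianSpace

/-! ### The range of the extended operator -/

section Range

variable {T : ℝ} {m : StieltjesFunction ℝ} {K : ℝ → ℝ → ℝ}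

instance isFiniteMeasure_bracketMeasure (T : ℝ) (m : StieltjesFunction ℝ) :
    IsFiniteMeasure (bracketMeasure T m) :=
  ⟨by simp [bracketMeasure]⟩

theorem isometry_kStarExt (hK : RegularKernel T m K) (u : Icc (0 : ℝ) T) :
    Isometry (kStarExt hK u) :=
  Isometry.completion_extension (AddMonoidHomClass.isometry_of_norm (kStarStep hK u) fun _ => rfl)

theorem kStarExt_add (hK : RegularKernel T m K) (u : Icc (0 : ℝ) T) (f g : Integrand hK u) :
    kStarExt hK u (f + g) = kStarExt hK u f + kStarExt hK u g := by
  have hc := (isometry_kStarExt hK u).continuous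
  induction f, g using UniformSpace.Completion.induction_on₂ with
  | hp => exact isClosed_eq (by fun_prop) (by fun_prop)
  | ih f g =>
    rw [← UniformSpace.Completion.coe_add, kStarExt_coe, kStarExt_coe, kStarExt_coe, map_add]

theorem range_kStarStep (hK : RegularKernel T m K) (u : Icc (0 : ℝ) T) :
    LinearMap.range (kStarStep hK u) =
      Submodule.span ℝ (range fun t : Iic u => (hK.memLp t t.1.2).toLp) := by
  have h : kStarStep hK u =
      Finsupp.linearCombination ℝ (fun t : Iic u => (hK.memLp t t.1.2).toLp) := by
    refine Finsupp.lhom_ext' fun t => LinearMap.ext_ring ?_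
    change kStarStep hK u (Finsupp.single t 1) = Finsupp.linearCombination ℝ _ (Finsupp.single t 1)
    rw [kStarStep_single, Finsupp.linearCombination_single, one_smul]
  rw [h]
  exact Finsupp.range_linearCombination ℝ

theorem range_kStarExt (hK : RegularKernel T m K) (u : Icc (0 : ℝ) T) :
    range (kStarExt hK u) = (LinearMap.range (kStarStep hK u)).topologicalClosure := by
  have hiso := isometry_kStarExt hK u
  rw [Submodule.topologicalClosure_coe]
  refine Subset.antisymm ?_ (closure_minimal ?_ hiso.isClosedEmbedding.isClosed_range)
  · rintro _ ⟨f, rfl⟩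
    induction f using UniformSpace.Completion.induction_on with
    | hp => exact isClosed_closure.preimage hiso.continuous
    | ih f => exact subset_closure ⟨f, (kStarExt_coe hK u f).symm⟩
  · rintro _ ⟨f, rfl⟩
    exact ⟨f, kStarExt_coe hK u f⟩

theorem range_kStarExt_mono (hK : RegularKernel T m K) {t u : Icc (0 : ℝ) T} (htu : t ≤ u) :
    range (kStarExt hK t) ⊆ range (kStarExt hK u) := by
  rw [range_kStarExt, range_kStarExt, range_kStarStep, range_kStarStep]
  refine Submodule.topologicalClosure_mono (Submodule.span_mono ?_)
  rintro _ ⟨s, rfl⟩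
  exact ⟨⟨s.1, le_trans s.2 htu⟩, rfl⟩

/-- A function whose integrals over the intervals `[0, t)`, `t ≤ u`, vanish is zero on `[0, u)`,
because these intervals form a `π`-system that generates the Borel sets. -/
theorem ae_eq_zero_of_setIntegral_Ico {μ : Measure ℝ} {h : ℝ → ℝ} {u : ℝ} (hu : 0 ≤ u)
    (hint : Integrable h μ) (h0 : ∀ t ∈ Icc 0 u, ∫ x in Ico 0 t, h x ∂μ = 0) :
    h =ᵐ[μ.restrict (Ico 0 u)] 0 := by
  have hint' : Integrable h (μ.restrict (Ico 0 u)) := hint.restrict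
  have huniv : ∫ x in Ico 0 u, h x ∂μ = 0 := h0 u ⟨hu, le_rfl⟩
  suffices hzero : ∀ s, MeasurableSet s → ∫ x in s, h x ∂(μ.restrict (Ico 0 u)) = 0 from
    hint'.ae_eq_zero_of_forall_setIntegral_eq_zero fun s hs _ => hzero s hs
  intro s hs
  induction s, hs using MeasurableSpace.induction_on_inter
    (BorelSpace.measurable_eq.trans (borel_eq_generateFrom_Iio ℝ)) isPiSystem_Iio with
  | empty => simp
  | basic s hs =>
    obtain ⟨a, rfl⟩ := hs
    have hset : Iio a ∩ Ico 0 u = Ico 0 (max 0 (min a u)) := by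
      ext x
      simp only [mem_inter_iff, mem_Iio, mem_Ico, lt_max_iff, lt_min_iff]
      constructor
      · rintro ⟨h1, h2, h3⟩
        exact ⟨h2, Or.inr ⟨h1, h3⟩⟩
      · rintro ⟨h1, h2 | h2⟩
        · exact absurd h1 (not_le.2 h2)
        · exact ⟨h2.1, h1, h2.2⟩
    rw [Measure.restrict_restrict measurableSet_Iio, hset]
    exact h0 _ ⟨le_max_left _ _, max_le hu (min_le_right _ _)⟩
  | compl s hs ih =>
    rw [setIntegral_compl hs hint', ih, huniv, sub_zero]
  | iUnion f hd hf ih =>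
    rw [integral_iUnion hf hd hint'.integrableOn]
    simp [ih]

/-- If `K*[f] = 1_{[0,t)}` is solvable for all `t ≤ u`, then `K*` maps the integrands on `[0, u]`
onto the functions in `L²(dm)` that vanish outside `[0, u)`. -/
theorem exists_kStarExt_eq_indicator (hK : RegularKernel T m K)
    (hinv : ∀ t : Icc (0 : ℝ) T, ∃ f : Integrand hK t,
      kStarExt hK t f =ᵐ[bracketMeasure T m] (Ico 0 (t : ℝ)).indicator 1)
    (u : Icc (0 : ℝ) T) {g : ℝ → ℝ} (hg : MemLp g 2 (bracketMeasure T m)) :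
    ∃ f : Integrand hK u,
      kStarExt hK u f =ᵐ[bracketMeasure T m] (Ico 0 (u : ℝ)).indicator g := by
  set N := (LinearMap.range (kStarStep hK u)).topologicalClosure
  have hgu : MemLp ((Ico 0 (u : ℝ)).indicator g) 2 (bracketMeasure T m) :=
    hg.indicator measurableSet_Ico
  have hNc : CompleteSpace N := (Submodule.isClosed_topologicalClosure _).completeSpace_coe
  suffices hmem : hgu.toLp ∈ N by
    rw [← SetLike.mem_coe, ← range_kStarExt] at hmem
    obtain ⟨f, hf⟩ := hmem
    exact ⟨f, by rw [hf]; exact hgu.coeFn_toLp⟩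
  rw [← Submodule.orthogonal_orthogonal N, Submodule.mem_orthogonal]
  intro h hh
  have h0 : h =ᵐ[(bracketMeasure T m).restrict (Ico 0 (u : ℝ))] 0 := by
    refine ae_eq_zero_of_setIntegral_Ico u.2.1 ((Lp.memLp h).integrable one_le_two) ?_
    intro t ht
    obtain ⟨f, hf⟩ := hinv ⟨t, ht.1, ht.2.trans u.2.2⟩
    have hfN : kStarExt hK _ f ∈ N := by
      rw [← SetLike.mem_coe, ← range_kStarExt]
      exact range_kStarExt_mono hK (Subtype.mk_le_mk.2 ht.2) (mem_range_self f)
    have horth := (Submodule.mem_orthogonal N h).1 hh _ hfN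
    rw [L2.inner_def] at horth
    rw [← integral_indicator measurableSet_Ico]
    refine Eq.trans (integral_congr_ae ?_) horth
    filter_upwards [hf] with x hx
    rw [hx]
    by_cases hxt : x ∈ Ico 0 t <;> simp [hxt]
  rw [L2.inner_def]
  refine integral_eq_zero_of_ae ?_
  filter_upwards [hgu.coeFn_toLp, (ae_restrict_iff' measurableSet_Ico).1 h0] with x h1 h2
  rw [h1]
  by_cases hx : x ∈ Ico 0 (u : ℝ)
  · simp [h2 hx]
  · simp [hx]

end Range

/-! ### The Wiener integral -/

theorem measurable_past {Ω : Type*} {T : ℝ} {X : Icc (0 : ℝ) T → Ω → ℝ} {u s : Icc (0 : ℝ) T}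
    (hs : s ≤ u) : Measurable[past X u] (X s) :=
  (comap_measurable (X s)).mono
    (le_iSup₂ (f := fun s (_ : s ∈ Iic u) => MeasurableSpace.comap (X s) inferInstance) s hs) le_rfl

/-- The past is generated by the restriction of the process to `[0, u]`, as one random element of
the product space. -/
theorem past_eq_comap {Ω : Type*} {T : ℝ} (X : Icc (0 : ℝ) T → Ω → ℝ) (u : Icc (0 : ℝ) T) :
    past X u = MeasurableSpace.comap (fun ω (s : Iic u) => X s ω) MeasurableSpace.pi := by
  rw [past, MeasurableSpace.pi, MeasurableSpace.comap_iSup, iSup_subtype']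
  simp only [MeasurableSpace.comap_comp]
  rfl

section Wiener

variable {T : ℝ} {m : StieltjesFunction ℝ} {K : ℝ → ℝ → ℝ} {Ω : Type*} [MeasurableSpace Ω]
  {P : Measure Ω} {X : Icc (0 : ℝ) T → Ω → ℝ}

theorem isometry_wienerIntegral (hX : IsRegularInvertible T m K X P) (u : Icc (0 : ℝ) T) :
    Isometry (wienerIntegral hX u) :=
  Isometry.completion_extension
    (AddMonoidHomClass.isometry_of_norm (wienerStep hX u) (norm_wienerStep hX u))

theorem wienerIntegral_add (hX : IsRegularInvertible T m K X P) (u : Icc (0 : ℝ) T)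
    (f g : Integrand hX.kernel u) :
    wienerIntegral hX u (f + g) = wienerIntegral hX u f + wienerIntegral hX u g := by
  have hc := (isometry_wienerIntegral hX u).continuous
  induction f, g using UniformSpace.Completion.induction_on₂ with
  | hp => exact isClosed_eq (by fun_prop) (by fun_prop)
  | ih f g =>
    rw [← UniformSpace.Completion.coe_add, wienerIntegral_coe, wienerIntegral_coe,
      wienerIntegral_coe, map_add]

/-- The isometry `E[∫ f dX ∫ g dX] = ∫ K*[f] K*[g] dm`. -/
theorem inner_wienerIntegral (hX : IsRegularInvertible T m K X P) (u : Icc (0 : ℝ) T)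
    (f g : Integrand hX.kernel u) :
    inner ℝ (wienerIntegral hX u f) (wienerIntegral hX u g) =
      inner ℝ (kStarExt hX.kernel u f) (kStarExt hX.kernel u g) := by
  have hc := (isometry_wienerIntegral hX u).continuous
  have hc' := (isometry_kStarExt hX.kernel u).continuous
  induction f, g using UniformSpace.Completion.induction_on₂ with
  | hp => exact isClosed_eq (by fun_prop) (by fun_prop)
  | ih f g =>
    rw [wienerIntegral_coe, wienerIntegral_coe, kStarExt_coe, kStarExt_coe, inner_wienerStep]

theorem wienerStep_mem_span (hX : IsRegularInvertible T m K X P) (u : Icc (0 : ℝ) T)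
    (f : StepFn hX.kernel u) :
    wienerStep hX u f ∈
      Submodule.span ℝ (range fun t : Iic u =>
        (hX.gaussian.hasGaussianLaw_eval t.1).memLp_two.toLp) := by
  rw [← Finsupp.range_linearCombination ℝ]
  exact ⟨f, rfl⟩

theorem wienerIntegral_mem_gaussianSpace (hX : IsRegularInvertible T m K X P) (u : Icc (0 : ℝ) T)
    (f : Integrand hX.kernel u) : wienerIntegral hX u f ∈ gaussianSpace hX.gaussian := by
  induction f using UniformSpace.Completion.induction_on with
  | hp =>
    exact (Submodule.isClosed_topologicalClosure _).preimage
      (isometry_wienerIntegral hX u).continuous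
  | ih f =>
    rw [wienerIntegral_coe]
    refine Submodule.le_topologicalClosure _ (Submodule.span_mono ?_ (wienerStep_mem_span hX u f))
    rintro _ ⟨t, rfl⟩
    exact ⟨t.1, rfl⟩

theorem past_le (hX : IsRegularInvertible T m K X P) (u : Icc (0 : ℝ) T) :
    past X u ≤ ‹MeasurableSpace Ω› :=
  iSup₂_le fun s _ => (hX.measurable s).comap_le

theorem aestronglyMeasurable_wienerIntegral (hX : IsRegularInvertible T m K X P)
    (u : Icc (0 : ℝ) T) (f : Integrand hX.kernel u) :
    AEStronglyMeasurable[past X u] (wienerIntegral hX u f) P := by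
  induction f using UniformSpace.Completion.induction_on with
  | hp =>
    exact (isClosed_aestronglyMeasurable (past_le hX u)).preimage
      (isometry_wienerIntegral hX u).continuous
  | ih f =>
    rw [wienerIntegral_coe]
    have hle : Submodule.span ℝ (range fun t : Iic u =>
        (hX.gaussian.hasGaussianLaw_eval t.1).memLp_two.toLp) ≤ lpMeas ℝ ℝ (past X u) 2 P := by
      refine Submodule.span_le.2 ?_
      rintro _ ⟨t, rfl⟩
      exact mem_lpMeas_iff_aestronglyMeasurable.2
        ((measurable_past t.2).stronglyMeasurable.aestronglyMeasurable.congr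
          (hX.gaussian.hasGaussianLaw_eval t.1).memLp_two.coeFn_toLp.symm)
    exact mem_lpMeas_iff_aestronglyMeasurable.1 (hle (wienerStep_mem_span hX u f))

/-- The indicator `1_{[0,t)}` as an integrand on `[0, u]`, for `t ≤ u`. -/
def indicatorIntegrand (hK : RegularKernel T m K) {u : Icc (0 : ℝ) T} (t : Iic u) :
    Integrand hK u :=
  UniformSpace.Completion.coe' (Finsupp.single t 1 : StepFn hK u)

theorem kStarExt_indicatorIntegrand (hK : RegularKernel T m K) {u : Icc (0 : ℝ) T} (t : Iic u) :
    kStarExt hK u (indicatorIntegrand hK t) = (hK.memLp t t.1.2).toLp :=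
  (kStarExt_coe hK u _).trans (kStarStep_single hK u t)

theorem wienerIntegral_indicatorIntegrand (hX : IsRegularInvertible T m K X P)
    {u : Icc (0 : ℝ) T} (t : Iic u) :
    wienerIntegral hX u (indicatorIntegrand hX.kernel t) =
      (hX.gaussian.hasGaussianLaw_eval t.1).memLp_two.toLp :=
  (wienerIntegral_coe hX u _).trans (wienerStep_single hX u t)

theorem kernel_ae_eq_indicator (hK : RegularKernel T m K) {t u : Icc (0 : ℝ) T} (htu : t ≤ u) :
    K t =ᵐ[bracketMeasure T m] (Ico 0 (u : ℝ)).indicator (K t) := by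
  have hu : ∀ᵐ s ∂(bracketMeasure T m), s ≠ (u : ℝ) := by
    rw [ae_iff]
    simpa using bracketMeasure_singleton hK (u : ℝ)
  filter_upwards [ae_mem_Ioo hK, hu] with s h1 h2
  by_cases hs : s ∈ Ico 0 (u : ℝ)
  · simp [hs]
  · have hus : (u : ℝ) < s := lt_of_le_of_ne (not_lt.1 fun h => hs ⟨h1.1.le, h⟩) (Ne.symm h2)
    rw [indicator_of_notMem hs,
      hK.volterra t s t.2.1 (lt_of_le_of_lt (Subtype.coe_le_coe.2 htu) hus) h1.2.le]

/-- If `K*[Ψ] = 1_{[0,u)} (K(t,·) - K(u,·))`, then adding `1_{[0,u)}` to `Ψ` gives an integrand whose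
image is the part of `K(t,·)` on `[0, u)`. -/
theorem kStarExt_indicatorIntegrand_add (hK : RegularKernel T m K) {u t : Icc (0 : ℝ) T}
    {Ψ : Integrand hK u}
    (hΨ : kStarExt hK u Ψ =ᵐ[bracketMeasure T m] (Ico 0 (u : ℝ)).indicator (K t - K u)) :
    kStarExt hK u (indicatorIntegrand hK ⟨u, le_refl u⟩ + Ψ)
      =ᵐ[bracketMeasure T m] (Ico 0 (u : ℝ)).indicator (K t) := by
  rw [kStarExt_add, kStarExt_indicatorIntegrand]
  filter_upwards [Lp.coeFn_add ((hK.memLp u u.2).toLp) (kStarExt hK u Ψ), hΨ,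
    (hK.memLp u u.2).coeFn_toLp, kernel_ae_eq_indicator hK (le_refl u)] with s h1 h2 h3 h4
  rw [h1, Pi.add_apply, h2, h3, h4, ← Pi.add_apply, ← indicator_add']
  simp

end Wiener

/-! ### Conditional laws of functions of independent variables -/

section IndependentKernel

variable {Ω α β E : Type*} [MeasurableSpace Ω] [MeasurableSpace α] [MeasurableSpace β]
  [MeasurableSpace E] {P : Measure Ω}

/-- The kernel that sends `a` to the law of `F (a, b)` when `b` has law `ν`. -/
def sectionKernel (ν : Measure β) [SFinite ν] {F : α × β → E} (hF : Measurable F) :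
    Kernel α E where
  toFun a := ν.map fun b => F (a, b)
  measurable' := by
    refine Measure.measurable_of_measurable_coe _ fun B hB => ?_
    have h : ∀ a, ν.map (fun b => F (a, b)) B = ν (Prod.mk a ⁻¹' (F ⁻¹' B)) := fun a =>
      Measure.map_apply (hF.comp measurable_prodMk_left) hB
    simp only [h]
    exact measurable_measure_prodMk_left (hF hB)

theorem sectionKernel_apply (ν : Measure β) [SFinite ν] {F : α × β → E} (hF : Measurable F)
    (a : α) : sectionKernel ν hF a = ν.map fun b => F (a, b) := rfl

/-- If `Z` is independent of `U`, then freezing `U` in `F (U, Z)` gives a conditional law. No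
standard Borel assumption on `E` is needed, because the kernel is explicit. -/
theorem setLIntegral_sectionKernel [IsProbabilityMeasure P] {U : Ω → α} {Z : Ω → β}
    (hU : Measurable U) (hZ : Measurable Z) (hind : IndepFun U Z P) {F : α × β → E}
    (hF : Measurable F) {A : Set α} (hA : MeasurableSet A) {B : Set E} (hB : MeasurableSet B) :
    ∫⁻ ω in U ⁻¹' A, sectionKernel (P.map Z) hF (U ω) B ∂P =
      P (U ⁻¹' A ∩ (fun ω => F (U ω, Z ω)) ⁻¹' B) := by
  have hUprob : IsProbabilityMeasure (P.map U) := Measure.isProbabilityMeasure_map hU.aemeasurable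
  have hZprob : IsProbabilityMeasure (P.map Z) := Measure.isProbabilityMeasure_map hZ.aemeasurable
  have hS : MeasurableSet (Prod.fst ⁻¹' A ∩ F ⁻¹' B) := (measurable_fst hA).inter (hF hB)
  have hrhs : P (U ⁻¹' A ∩ (fun ω => F (U ω, Z ω)) ⁻¹' B) =
      ((P.map U).prod (P.map Z)) (Prod.fst ⁻¹' A ∩ F ⁻¹' B) := by
    rw [← (indepFun_iff_map_prod_eq_prod_map_map hU.aemeasurable hZ.aemeasurable).1 hind,
      Measure.map_apply (hU.prodMk hZ) hS]
    rfl
  rw [hrhs, Measure.prod_apply hS, ← setLIntegral_map hA (Kernel.measurable_coe _ hB) hU,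
    ← lintegral_indicator hA]
  refine lintegral_congr fun a => ?_
  by_cases ha : a ∈ A
  · rw [indicator_of_mem ha, sectionKernel_apply,
      Measure.map_apply (by fun_prop) hB]
    congr 1
    ext b
    simp [ha]
  · rw [indicator_of_notMem ha, preimage_inter, ← preimage_comp]
    have : Prod.fst ∘ Prod.mk a ⁻¹' A = (∅ : Set β) := by
      ext b
      simp [ha]
    rw [this, empty_inter, measure_empty]

end IndependentKernel

/-! ### Regression of a Gaussian process on the past -/

section Regression

variable {Ω ι : Type*} {𝓖 mΩ : MeasurableSpace Ω} {P : Measure Ω} {M Z : ι → Ω → ℝ}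

theorem measurable_add_pi (hM : ∀ i, Measurable[𝓖] (M i)) :
    Measurable[𝓖.prod MeasurableSpace.pi]
      fun (p : Ω × (ι → ℝ)) i => M i p.1 + p.2 i :=
  measurable_pi_lambda _ fun i =>
    ((hM i).comp measurable_fst).add ((measurable_pi_apply i).comp measurable_snd)

theorem measurable_const_add_pi (hZ : ∀ i, Measurable (Z i)) (c : ι → ℝ) :
    Measurable fun ω i => c i + Z i ω :=
  measurable_pi_lambda _ fun i => measurable_const.add (hZ i)

/-- The conditional law of the process `M + Z` given `𝓖`, when `M` is `𝓖`-measurable and `Z` has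
law `ν` and is independent of `𝓖`: the law `ν` translated by `M ω`. -/
def translationKernel (hM : ∀ i, Measurable[𝓖] (M i)) (ν : Measure (ι → ℝ)) [SFinite ν] :
    @Kernel Ω (ι → ℝ) 𝓖 _ :=
  @sectionKernel Ω (ι → ℝ) (ι → ℝ) 𝓖 _ _ ν _ _ (measurable_add_pi hM)

theorem translationKernel_apply (hM : ∀ i, Measurable[𝓖] (M i)) (ν : Measure (ι → ℝ)) [SFinite ν]
    (ω : Ω) : translationKernel hM ν ω = ν.map fun z i => M i ω + z i := rfl

theorem translationKernel_map_apply [SFinite P] (hM : ∀ i, Measurable[𝓖] (M i))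
    (hZ : ∀ i, Measurable (Z i)) (ω : Ω) :
    translationKernel hM (P.map fun ω' i => Z i ω') ω = P.map fun ω' i => M i ω + Z i ω' := by
  rw [translationKernel_apply, Measure.map_map (by fun_prop) (by fun_prop)]
  rfl

theorem isRegularCondLaw_translationKernel [IsProbabilityMeasure P] (h𝓖 : 𝓖 ≤ mΩ)
    (hM : ∀ i, Measurable[𝓖] (M i)) (hZ : ∀ i, Measurable (Z i))
    (hind : Indep 𝓖 (MeasurableSpace.comap (fun ω i => Z i ω) MeasurableSpace.pi) P) :
    IsRegularCondLaw 𝓖 P (fun ω i => M i ω + Z i ω)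
      (translationKernel hM (P.map fun ω i => Z i ω)) := by
  have hZ' : Measurable fun ω i => Z i ω := measurable_pi_lambda _ hZ
  refine ⟨fun ω => ?_, fun A hA B hB => ?_⟩
  · rw [translationKernel_map_apply hM hZ]
    exact Measure.isProbabilityMeasure_map
      (measurable_const_add_pi hZ fun i => M i ω).aemeasurable
  · have hindep : @IndepFun Ω Ω (ι → ℝ) mΩ 𝓖 _ id (fun ω i => Z i ω) P :=
      (@IndepFun_iff_Indep Ω Ω (ι → ℝ) mΩ 𝓖 _ id _ P).2 (by rwa [MeasurableSpace.comap_id])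
    exact @setLIntegral_sectionKernel Ω Ω (ι → ℝ) (ι → ℝ) mΩ 𝓖 _ _ P _ id _
      (measurable_id'' h𝓖) hZ' hindep _ (measurable_add_pi hM) A hA B hB

theorem isGaussianProcess_translationKernel (hM : ∀ i, Measurable[𝓖] (M i))
    (hZ : ∀ i, Measurable (Z i)) (hgauss : IsGaussianProcess Z P) (ω : Ω) :
    haveI := hgauss.isProbabilityMeasure
    IsGaussianProcess (fun i (x : ι → ℝ) => x i)
      (translationKernel hM (P.map fun ω i => Z i ω) ω) where
  hasGaussianLaw I := by
    have := hgauss.isProbabilityMeasure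
    have hlaw := (hgauss.hasGaussianLaw I).isGaussian_map
    refine ⟨?_⟩
    have hIrestrict : Measurable fun ω' => I.restrict (Z · ω') :=
      measurable_pi_lambda _ fun i => hZ i
    rw [translationKernel_map_apply hM hZ, Measure.map_map (by fun_prop)
      (measurable_const_add_pi hZ fun i => M i ω)]
    have h : ((fun x : ι → ℝ => I.restrict fun i => x i) ∘ fun ω' i => M i ω + Z i ω') =
        (fun z => I.restrict (M · ω) + z) ∘ fun ω' => I.restrict (Z · ω') := rfl
    rw [h, ← Measure.map_map (by fun_prop) hIrestrict]
    infer_instance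

theorem integral_translationKernel [IsProbabilityMeasure P] (hM : ∀ i, Measurable[𝓖] (M i))
    (hZ : ∀ i, Measurable (Z i)) {i : ι} (hint : Integrable (Z i) P) (hzero : ∫ ω, Z i ω ∂P = 0)
    (ω : Ω) : ∫ x, x i ∂(translationKernel hM (P.map fun ω i => Z i ω) ω) = M i ω := by
  rw [translationKernel_map_apply hM hZ, integral_map
    (measurable_const_add_pi hZ fun i => M i ω).aemeasurable
      (measurable_pi_apply i).aestronglyMeasurable, integral_add (integrable_const _) hint,
    hzero, integral_const]
  simp

theorem covariance_translationKernel [IsProbabilityMeasure P] (hM : ∀ i, Measurable[𝓖] (M i))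
    (hZ : ∀ i, Measurable (Z i)) (hint : ∀ i, Integrable (Z i) P) (i j : ι) (ω : Ω) :
    covariance (fun x : ι → ℝ => x i) (fun x => x j)
      (translationKernel hM (P.map fun ω i => Z i ω) ω) = cov[Z i, Z j; P] := by
  rw [translationKernel_map_apply hM hZ, covariance_map
    (measurable_pi_apply i).aestronglyMeasurable (measurable_pi_apply j).aestronglyMeasurable
    (measurable_const_add_pi hZ fun i => M i ω).aemeasurable]
  change cov[fun ω' => M i ω + Z i ω', fun ω' => M j ω + Z j ω'; P] = _
  rw [covariance_const_add_left (hint i), covariance_const_add_right (hint j)]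

/-- The regression function `M` is the conditional mean of `M + Z`. -/
theorem condExp_add_indep [IsProbabilityMeasure P] (h𝓖 : 𝓖 ≤ mΩ)
    (hM : ∀ i, Measurable[𝓖] (M i)) (hZ : ∀ i, Measurable (Z i))
    (hind : Indep 𝓖 (MeasurableSpace.comap (fun ω i => Z i ω) MeasurableSpace.pi) P) {i : ι}
    (hMint : Integrable (M i) P) (hint : Integrable (Z i) P) (hzero : ∫ ω, Z i ω ∂P = 0) :
    P[M i + Z i | 𝓖] =ᵐ[P] M i := by
  have hZi : P[Z i | 𝓖] =ᵐ[P] fun _ => ∫ ω, Z i ω ∂P := by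
    refine condExp_indep_eq (measurable_pi_lambda _ hZ).comap_le h𝓖 ?_ hind.symm
    exact ((measurable_pi_apply i).comp (comap_measurable fun ω i => Z i ω)).stronglyMeasurable
  filter_upwards [condExp_add hMint hint 𝓖, hZi] with ω h1 h2
  rw [h1, Pi.add_apply, h2, hzero, add_zero,
    condExp_of_stronglyMeasurable h𝓖 (hM i).stronglyMeasurable hMint]

/-- The conditional covariance of `M + Z` is the covariance of the remainder `Z`. -/
theorem condCov_add_indep [IsProbabilityMeasure P] (h𝓖 : 𝓖 ≤ mΩ)
    (hM : ∀ i, Measurable[𝓖] (M i)) (hZ : ∀ i, Measurable (Z i))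
    (hind : Indep 𝓖 (MeasurableSpace.comap (fun ω i => Z i ω) MeasurableSpace.pi) P)
    (hMint : ∀ i, Integrable (M i) P) (hint : ∀ i, Integrable (Z i) P)
    (hzero : ∀ i, ∫ ω, Z i ω ∂P = 0) (i j : ι) :
    condCov 𝓖 P (M i + Z i) (M j + Z j) =ᵐ[P] fun _ => ∫ ω, Z i ω * Z j ω ∂P := by
  have hcomap : Measurable[MeasurableSpace.comap (fun ω i => Z i ω) MeasurableSpace.pi]
      (fun ω i => Z i ω) := comap_measurable _
  have hmul : P[Z i * Z j | 𝓖] =ᵐ[P] fun _ => ∫ ω, Z i ω * Z j ω ∂P := by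
    refine condExp_indep_eq (measurable_pi_lambda _ hZ).comap_le h𝓖 ?_ hind.symm
    exact (((measurable_pi_apply i).comp hcomap).mul
      ((measurable_pi_apply j).comp hcomap)).stronglyMeasurable
  refine (condExp_congr_ae ?_).trans hmul
  filter_upwards [condExp_add_indep h𝓖 hM hZ hind (hMint i) (hint i) (hzero i),
    condExp_add_indep h𝓖 hM hZ hind (hMint j) (hint j) (hzero j)] with ω h1 h2
  simp [h1, h2]

end Regression

/-! ### Prediction -/

section Prediction

variable {T : ℝ} {m : StieltjesFunction ℝ} {K : ℝ → ℝ → ℝ} {Ω : Type*} [MeasurableSpace Ω]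
  {P : Measure Ω} {X : Icc (0 : ℝ) T → Ω → ℝ}

theorem inner_eq_integral_mul {α : Type*} [MeasurableSpace α] {μ : Measure α} {f g : α → ℝ}
    {x y : Lp ℝ 2 μ} (hf : f =ᵐ[μ] x) (hg : g =ᵐ[μ] y) :
    inner ℝ x y = ∫ a, f a * g a ∂μ := by
  rw [L2.inner_def]
  refine integral_congr_ae ?_
  filter_upwards [hf, hg] with a h1 h2
  rw [h1, h2, mul_comm]
  rfl

theorem integral_eq_zero_of_mem_gaussianSpace (hX : IsRegularInvertible T m K X P) {f : Ω → ℝ}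
    {y : Lp ℝ 2 P} (hy : y ∈ gaussianSpace hX.gaussian) (hf : f =ᵐ[P] y) : ∫ ω, f ω ∂P = 0 := by
  have h := gaussianSpace_subset_centeredGaussians hX.gaussian hX.centered hy
  rw [centeredGaussians, mem_ofPred_eq] at h
  rw [integral_congr_ae hf, ← integral_map (f := fun x => x)
    (Lp.aestronglyMeasurable y).aemeasurable (by fun_prop), h, integral_id_gaussianReal]

/-- The isometry also holds between a value `X t` beyond `u` and an integral over `[0, u]`. -/
theorem inner_toLp_wienerIntegral (hX : IsRegularInvertible T m K X P) (u t : Icc (0 : ℝ) T)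
    (f : Integrand hX.kernel u) :
    inner ℝ (hX.gaussian.hasGaussianLaw_eval t).memLp_two.toLp (wienerIntegral hX u f) =
      inner ℝ (hX.kernel.memLp t t.2).toLp (kStarExt hX.kernel u f) := by
  have hc := (isometry_wienerIntegral hX u).continuous
  have hc' := (isometry_kStarExt hX.kernel u).continuous
  induction f using UniformSpace.Completion.induction_on with
  | hp => exact isClosed_eq (by fun_prop) (by fun_prop)
  | ih f =>
    rw [wienerIntegral_coe, kStarExt_coe]
    have h : (innerₗ _ (hX.gaussian.hasGaussianLaw_eval t).memLp_two.toLp).comp (wienerStep hX u) =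
        (innerₗ _ (hX.kernel.memLp t t.2).toLp).comp (kStarStep hX.kernel u) := by
      refine Finsupp.lhom_ext' fun s => LinearMap.ext_ring ?_
      change inner ℝ _ (wienerStep hX u (Finsupp.single s 1)) =
        inner ℝ _ (kStarStep hX.kernel u (Finsupp.single s 1))
      let T' : Icc (0 : ℝ) T := ⟨T, t.2.1.trans t.2.2, le_rfl⟩
      have hT := inner_wienerStep hX T' (Finsupp.single ⟨t, t.2.2⟩ 1)
        (Finsupp.single ⟨s.1, s.1.2.2⟩ 1)
      rw [wienerStep_single, wienerStep_single, kStarStep_single, kStarStep_single] at hT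
      rw [wienerStep_single, kStarStep_single]
      exact hT
    exact LinearMap.congr_fun h f

variable {u : Icc (0 : ℝ) T}

/-- If `K*[Φ]` is the part of `K(t,·)` on `[0, u)`, then the error `X t - ∫ Φ dX` is orthogonal to
all integrals over `[0, u]`. -/
theorem inner_sub_wienerIntegral (hX : IsRegularInvertible T m K X P) {t : Icc (0 : ℝ) T}
    {Φ f : Integrand hX.kernel u}
    (hΦ : kStarExt hX.kernel u Φ =ᵐ[bracketMeasure T m] (Ico 0 (u : ℝ)).indicator (K t))
    {g : ℝ → ℝ}
    (hf : kStarExt hX.kernel u f =ᵐ[bracketMeasure T m] (Ico 0 (u : ℝ)).indicator g) :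
    inner ℝ ((hX.gaussian.hasGaussianLaw_eval t).memLp_two.toLp - wienerIntegral hX u Φ)
      (wienerIntegral hX u f) = 0 := by
  rw [inner_sub_left, inner_toLp_wienerIntegral, inner_wienerIntegral,
    inner_eq_integral_mul (hX.kernel.memLp t t.2).coeFn_toLp.symm hf.symm,
    inner_eq_integral_mul hΦ.symm hf.symm, sub_eq_zero]
  congr 1
  ext v
  by_cases hv : v ∈ Ico 0 (u : ℝ) <;> simp [hv]

theorem inner_kStarExt_toLp (hK : RegularKernel T m K) {t s : Icc (0 : ℝ) T}
    {Φ : Integrand hK u}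
    (hΦ : kStarExt hK u Φ =ᵐ[bracketMeasure T m] (Ico 0 (u : ℝ)).indicator (K t)) :
    inner ℝ (kStarExt hK u Φ) (hK.memLp s s.2).toLp =
      ∫ v in Ioc 0 (u : ℝ), K t v * K s v ∂m.measure := by
  rw [inner_eq_integral_mul hΦ.symm (hK.memLp s s.2).coeFn_toLp.symm,
    ← inter_eq_left.2 (Ioc_subset_Ioc_right u.2.2 : Ioc 0 (u : ℝ) ⊆ Ioc 0 T),
    ← Measure.restrict_restrict measurableSet_Ioc, ← integral_indicator measurableSet_Ioc]
  refine integral_congr_ae ?_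
  have hu : ∀ᵐ v ∂(bracketMeasure T m), v ≠ (u : ℝ) := by
    rw [ae_iff]
    simpa using bracketMeasure_singleton hK (u : ℝ)
  filter_upwards [ae_mem_Ioo hK, hu] with v hv hvu
  by_cases h : v < u
  · rw [indicator_of_mem (show v ∈ Ico 0 (u : ℝ) from ⟨hv.1.le, h⟩),
      indicator_of_mem (show v ∈ Ioc 0 (u : ℝ) from ⟨hv.1, h.le⟩)]
  · rw [indicator_of_notMem fun h' => h h'.2,
      indicator_of_notMem fun h' => h (lt_of_le_of_ne h'.2 hvu), zero_mul]

/-- The remainder process is independent of the past: jointly with the past it lives in one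
Gaussian Hilbert space, and it is orthogonal to the past there. -/
theorem indep_past_remainder (hX : IsRegularInvertible T m K X P) {ι : Type*}
    {t : ι → Icc (0 : ℝ) T} {Φ : ι → Integrand hX.kernel u}
    (hΦ : ∀ i, kStarExt hX.kernel u (Φ i) =ᵐ[bracketMeasure T m]
      (Ico 0 (u : ℝ)).indicator (K (t i)))
    {Z : ι → Ω → ℝ}
    (hZ : ∀ i, Z i =ᵐ[P] ((hX.gaussian.hasGaussianLaw_eval (t i)).memLp_two.toLp -
      wienerIntegral hX u (Φ i) : Lp ℝ 2 P)) :
    Indep (past X u) (MeasurableSpace.comap (fun ω i => Z i ω) MeasurableSpace.pi) P := by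
  have := hX.gaussian.isProbabilityMeasure
  have hmem : ∀ i, (hX.gaussian.hasGaussianLaw_eval (t i)).memLp_two.toLp -
      wienerIntegral hX u (Φ i) ∈ gaussianSpace hX.gaussian := fun i =>
    Submodule.sub_mem _ (toLp_mem_gaussianSpace _ _) (wienerIntegral_mem_gaussianSpace hX u _)
  have hjoint : IsGaussianProcess (Sum.elim (fun s : Iic u => X s) Z) P := by
    refine isGaussianProcess_of_mem_gaussianSpace hX.gaussian hX.centered
      (y := Sum.elim (fun s : Iic u => (hX.gaussian.hasGaussianLaw_eval s.1).memLp_two.toLp)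
        fun i => (hX.gaussian.hasGaussianLaw_eval (t i)).memLp_two.toLp -
          wienerIntegral hX u (Φ i)) ?_ ?_
    · rintro (s | i)
      · exact toLp_mem_gaussianSpace _ _
      · exact hmem i
    · rintro (s | i)
      · exact (hX.gaussian.hasGaussianLaw_eval s.1).memLp_two.coeFn_toLp.symm
      · exact hZ i
  have hZL : ∀ i, MemLp (Z i) 2 P := fun i => (Lp.memLp _).ae_eq (hZ i).symm
  rw [past_eq_comap, ← IndepFun_iff_Indep]
  refine hjoint.indepFun_of_covariance_eq_zero (fun s => (hX.measurable s).aemeasurable)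
    (fun i => (hZL i).aestronglyMeasurable.aemeasurable) fun s i => ?_
  rw [covariance_eq_sub (hX.gaussian.hasGaussianLaw_eval s.1).memLp_two (hZL i), hX.centered,
    zero_mul, sub_zero]
  have hs : kStarExt hX.kernel u (indicatorIntegrand hX.kernel s) =ᵐ[bracketMeasure T m]
      (Ico 0 (u : ℝ)).indicator (K s) := by
    rw [kStarExt_indicatorIntegrand]
    exact (hX.kernel.memLp s s.1.2).coeFn_toLp.trans (kernel_ae_eq_indicator hX.kernel s.2)
  have horth := inner_sub_wienerIntegral hX (hΦ i) hs
  rw [wienerIntegral_indicatorIntegrand, real_inner_comm,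
    inner_eq_integral_mul (hX.gaussian.hasGaussianLaw_eval s.1).memLp_two.coeFn_toLp.symm
      (hZ i)] at horth
  exact horth

/-- The covariance of the remainder process. -/
theorem integral_remainder_mul (hX : IsRegularInvertible T m K X P)
    {t s : Icc (0 : ℝ) T} {Φ Φ' : Integrand hX.kernel u}
    (hΦ : kStarExt hX.kernel u Φ =ᵐ[bracketMeasure T m] (Ico 0 (u : ℝ)).indicator (K t))
    (hΦ' : kStarExt hX.kernel u Φ' =ᵐ[bracketMeasure T m] (Ico 0 (u : ℝ)).indicator (K s))
    {Z Z' : Ω → ℝ}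
    (hZ : Z =ᵐ[P] ((hX.gaussian.hasGaussianLaw_eval t).memLp_two.toLp -
      wienerIntegral hX u Φ : Lp ℝ 2 P))
    (hZ' : Z' =ᵐ[P] ((hX.gaussian.hasGaussianLaw_eval s).memLp_two.toLp -
      wienerIntegral hX u Φ' : Lp ℝ 2 P)) :
    ∫ ω, Z ω * Z' ω ∂P = (∫ ω, X t ω * X s ω ∂P) -
      ∫ v in Ioc 0 (u : ℝ), K t v * K s v ∂m.measure := by
  rw [← inner_eq_integral_mul hZ hZ', inner_sub_right, inner_sub_wienerIntegral hX hΦ hΦ', sub_zero,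
    inner_sub_left, real_inner_comm _ (wienerIntegral hX u Φ), inner_toLp_wienerIntegral,
    real_inner_comm, real_inner_comm _ (hX.kernel.memLp s s.2).toLp,
    inner_kStarExt_toLp hX.kernel hΦ, real_inner_comm]
  congr 1
  exact inner_eq_integral_mul (hX.gaussian.hasGaussianLaw_eval t).memLp_two.coeFn_toLp.symm
    (hX.gaussian.hasGaussianLaw_eval s).memLp_two.coeFn_toLp.symm

end Prediction

end GaussianVolterra

end

/-! ### Conditional mean, covariance and law -/

open GaussianVolterra

theorem theorem4p1 {Ω : Type*} [MeasurableSpace Ω] {P : MeasureTheory.Measure Ω}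
    [MeasureTheory.IsProbabilityMeasure P] {T : ℝ} (hT : 0 < T) {m : StieltjesFunction ℝ}
    {K : ℝ → ℝ → ℝ} {X : Set.Icc (0 : ℝ) T → Ω → ℝ}
    (hX : GaussianVolterra.IsRegularInvertible T m K X P) (u : Set.Icc (0 : ℝ) T) :
    -- the conditional mean, with `Ψ = (K*)⁻¹[K(t,·) - K(u,·)]` on `[0, u]`
    (∀ t ∈ Set.Ici u,
      (∃! Ψ : GaussianVolterra.Integrand hX.kernel u,
        GaussianVolterra.kStarExt hX.kernel u Ψ =ᵐ[GaussianVolterra.bracketMeasure T m]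
          (Set.Ico 0 (u : ℝ)).indicator (K t - K u)) ∧
      ∀ Ψ : GaussianVolterra.Integrand hX.kernel u,
        GaussianVolterra.kStarExt hX.kernel u Ψ =ᵐ[GaussianVolterra.bracketMeasure T m]
          (Set.Ico 0 (u : ℝ)).indicator (K t - K u) →
        P[X t | GaussianVolterra.past X u] =ᵐ[P]
          X u + GaussianVolterra.wienerIntegral hX u Ψ) ∧
    -- the conditional covariance
    (∀ t ∈ Set.Ici u, ∀ s ∈ Set.Ici u,
      GaussianVolterra.condCov (GaussianVolterra.past X u) P (X t) (X s) =ᵐ[P]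
        fun _ => (∫ ω, X t ω * X s ω ∂P) - ∫ v in Set.Ioc 0 (u : ℝ), K t v * K s v ∂m.measure) ∧
    -- the conditional law of the process `(X_t)_{t ∈ [u, T]}` is Gaussian, with this mean and
    -- covariance
    ∃ κ : @ProbabilityTheory.Kernel Ω (Set.Ici u → ℝ) (GaussianVolterra.past X u) _,
      GaussianVolterra.IsRegularCondLaw (GaussianVolterra.past X u) P
        (fun ω (t : Set.Ici u) => X t ω) κ ∧
      (∀ᵐ ω ∂P, ProbabilityTheory.IsGaussianProcess (fun (t : Set.Ici u) x => x t) (κ ω)) ∧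
      (∀ t : Set.Ici u, ∀ᵐ ω ∂P, ∫ x, x t ∂(κ ω) = P[X t | GaussianVolterra.past X u] ω) ∧
      ∀ᵐ ω ∂P, ∀ t s : Set.Ici u, ProbabilityTheory.covariance (fun x => x t) (fun x => x s) (κ ω) =
        (∫ ω', X t ω' * X s ω' ∂P) - ∫ v in Set.Ioc 0 (u : ℝ), K t v * K s v ∂m.measure := by
  have hle := past_le hX u
  choose Ψ hΨ using fun t : Icc (0 : ℝ) T =>
    exists_kStarExt_eq_indicator hX.kernel hX.invertible u
      ((hX.kernel.memLp t t.2).sub (hX.kernel.memLp u u.2))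
  let Φ : Icc (0 : ℝ) T → Integrand hX.kernel u := fun t =>
    indicatorIntegrand hX.kernel ⟨u, le_refl u⟩ + Ψ t
  have hΦ := fun t => kStarExt_indicatorIntegrand_add hX.kernel (hΨ t)
  -- `wienerIntegral` is only almost surely measurable with respect to the past, whereas the kernel
  -- has to be measurable for every `ω`.
  let M : Ici u → Ω → ℝ := fun t => (aestronglyMeasurable_wienerIntegral hX u (Φ t)).mk
  have hM : ∀ t, Measurable[past X u] (M t) := fun t =>
    (aestronglyMeasurable_wienerIntegral hX u (Φ t)).stronglyMeasurable_mk.measurable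
  have hMΦ : ∀ t : Ici u, M t =ᵐ[P] wienerIntegral hX u (Φ t) := fun t =>
    (aestronglyMeasurable_wienerIntegral hX u (Φ t)).ae_eq_mk.symm
  let Z : Ici u → Ω → ℝ := fun t => X t - M t
  have hMZ : ∀ t : Ici u, M t + Z t = X t := fun t => add_sub_cancel _ _
  have hZ : ∀ t, Measurable (Z t) := fun t =>
    (hX.measurable t).sub ((hM t).mono hle le_rfl)
  have hZΦ : ∀ t : Ici u, Z t =ᵐ[P] ((hX.gaussian.hasGaussianLaw_eval t.1).memLp_two.toLp -
      wienerIntegral hX u (Φ t) : Lp ℝ 2 P) := by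
    intro t
    filter_upwards [hMΦ t, (hX.gaussian.hasGaussianLaw_eval t.1).memLp_two.coeFn_toLp,
      Lp.coeFn_sub (hX.gaussian.hasGaussianLaw_eval t.1).memLp_two.toLp
        (wienerIntegral hX u (Φ t))] with ω h1 h2 h3
    rw [h3, Pi.sub_apply, h2, ← h1]
    rfl
  have hmem : ∀ t : Ici u, (hX.gaussian.hasGaussianLaw_eval t.1).memLp_two.toLp -
      wienerIntegral hX u (Φ t) ∈ gaussianSpace hX.gaussian := fun t =>
    Submodule.sub_mem _ (toLp_mem_gaussianSpace _ _) (wienerIntegral_mem_gaussianSpace hX u _)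
  have hZgauss : IsGaussianProcess Z P :=
    isGaussianProcess_of_mem_gaussianSpace hX.gaussian hX.centered hmem hZΦ
  have hZzero : ∀ t, ∫ ω, Z t ω ∂P = 0 := fun t =>
    integral_eq_zero_of_mem_gaussianSpace hX (hmem t) (hZΦ t)
  have hZL : ∀ t, MemLp (Z t) 2 P := fun t => (hZgauss.hasGaussianLaw_eval t).memLp_two
  have hZint : ∀ t, Integrable (Z t) P := fun t => (hZL t).integrable one_le_two
  have hMint : ∀ t, Integrable (M t) P := fun t =>
    ((Lp.memLp _).integrable one_le_two).congr (hMΦ t).symm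
  have hind := indep_past_remainder hX (fun t : Ici u => hΦ t) hZΦ
  have hmean : ∀ t : Ici u, P[X t | past X u] =ᵐ[P] M t := fun t => by
    rw [← hMZ t]
    exact condExp_add_indep hle hM hZ hind (hMint t) (hZint t) (hZzero t)
  have hcov : ∀ t s : Ici u, ∫ ω, Z t ω * Z s ω ∂P = (∫ ω, X t ω * X s ω ∂P) -
      ∫ v in Ioc 0 (u : ℝ), K t v * K s v ∂m.measure := fun t s =>
    integral_remainder_mul hX (hΦ t) (hΦ s) (hZΦ t) (hZΦ s)
  have huniq : ∀ t : Icc (0 : ℝ) T, ∀ Ψ' : Integrand hX.kernel u,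
      kStarExt hX.kernel u Ψ' =ᵐ[bracketMeasure T m] (Ico 0 (u : ℝ)).indicator (K t - K u) →
        Ψ' = Ψ t := fun t Ψ' h =>
    (isometry_kStarExt hX.kernel u).injective (Lp.ext (h.trans (hΨ t).symm))
  refine ⟨fun t ht => ⟨⟨Ψ t, hΨ t, huniq t⟩, fun Ψ' hΨ' => ?_⟩, fun t ht s hs => ?_,
    translationKernel hM (P.map fun ω t => Z t ω), ?_, ?_, fun t => ?_, ?_⟩
  · rw [huniq t Ψ' hΨ']
    have hadd := wienerIntegral_add hX u (indicatorIntegrand hX.kernel ⟨u, le_refl u⟩) (Ψ t)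
    rw [wienerIntegral_indicatorIntegrand] at hadd
    filter_upwards [hmean ⟨t, ht⟩, hMΦ ⟨t, ht⟩,
      (hX.gaussian.hasGaussianLaw_eval u).memLp_two.coeFn_toLp,
      Lp.coeFn_add (hX.gaussian.hasGaussianLaw_eval u).memLp_two.toLp
        (wienerIntegral hX u (Ψ t))] with ω h1 h2 h3 h4
    rw [h1, h2, hadd, h4, Pi.add_apply, Pi.add_apply, h3]
  · have h := condCov_add_indep hle hM hZ hind hMint hZint hZzero ⟨t, ht⟩ ⟨s, hs⟩
    rw [hMZ, hMZ, hcov] at h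
    exact h
  · convert isRegularCondLaw_translationKernel hle hM hZ hind using 3 with ω t
    exact (congrFun (hMZ t) ω).symm
  · exact ae_of_all _ fun ω => isGaussianProcess_translationKernel hM hZ hZgauss ω
  · filter_upwards [hmean t] with ω hω
    rw [hω]
    exact integral_translationKernel hM hZ (hZint t) (hZzero t) ω
  · refine ae_of_all _ fun ω t s => ?_
    rw [covariance_translationKernel hM hZ hZint, covariance_eq_sub (hZL t) (hZL s), hZzero t,
      zero_mul, sub_zero]
    exact hcov t s
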